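/- Let $\mathbb{N}=\{0,1,2,\dots\}$ and for $t\in\mathbb{R}$ let $\|t\|=\min_{n\in\mathbb{Z}}|t-n|$ denote the distance to the nearest integer. For $\alpha\in\mathbb{R}$ and $\varepsilon:\mathbb{N}\to\mathbb{R}$ put $$\mathcal{A}^{\varepsilon}_{\alpha}=\{n\in\mathbb{N} : \|\alpha n^2\|<\varepsilon(n)\}.$$ A set $\mathcal{A}\subset\mathbb{N}$ is called a basis of order $2$ if $\mathcal{A}+\mathcal{A}=\{n_1+n_2 : n_1,n_2\in\mathcal{A}\}$ contains all sufficiently large integers. **Theorem.** (1) There is a set $Z\subset\mathbb{R}$ of Lebesgue measure $0$ such that for every $\alpha\in\mathbb{R}\setminus Z$: (a) for every $\varepsilon:\mathbb{N}\to\mathbb{R}$ with $\varepsilon(n)\to0$ as $n\to\infty$, the set $\mathcal{A}^{\varepsilon}_{\alpha}$ is not a basis of order $2$; (b) for every real $\varepsilon_0<\frac14$ and every $\varepsilon:\mathbb{N}\to\mathbb{R}$ with $\varepsilon(n)\le\varepsilon_0$ for all $n$, the set $\mathcal{A}^{\varepsilon}_{\alpha}$ is not a basis of order $2$. (2) For every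 $d\in\mathbb{N}$ and every $\alpha\in\mathbb{Q}(\sqrt d)\setminus\mathbb{Q}$: (a) for every $\varepsilon:\mathbb{N}\to\mathbb{R}$ with $\varepsilon(n)\to0$ as $n\to\infty$, the set $\mathcal{A}^{\varepsilon}_{\alpha}$ is not a basis of order $2$; (b) there is $\varepsilon_1=\varepsilon_1(\alpha)>0$ such that for every real $\varepsilon_0<\varepsilon_1$ and every $\varepsilon:\mathbb{N}\to\mathbb{R}$ with $\varepsilon(n)\le\varepsilon_0$ for all $n$, the set $\mathcal{A}^{\varepsilon}_{\alpha}$ is not a basis of order $2$. -/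

import Mathlib

/-- Distance from a real number to the nearest integer. -/
noncomputable def distNearestInt (t : ℝ) : ℝ := |t - (round t : ℝ)|

/-- `distNearestInt t` is the minimum of `|t - n|` over the integers `n`. -/
theorem distNearestInt_isLeast (t : ℝ) :
    IsLeast (Set.range fun n : ℤ => |t - (n : ℝ)|) (distNearestInt t) := by
  refine ⟨⟨round t, rfl⟩, ?_⟩
  rintro _ ⟨n, rfl⟩
  exact round_le t n

/-- The set `{n ∈ ℕ : ‖α n²‖ < ε(n)}`. -/
def quadBohrSet (ε : ℕ → ℝ) (α : ℝ) : Set ℕ :=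
  {n : ℕ | distNearestInt (α * (n : ℝ) ^ 2) < ε n}

/-- The `k`-fold sumset `{n₁ + ⋯ + nₖ : nᵢ ∈ A}`. -/
def kFoldSumset (k : ℕ) (A : Set ℕ) : Set ℕ :=
  {N : ℕ | ∃ f : Fin k → ℕ, (∀ i, f i ∈ A) ∧ ∑ i, f i = N}

/-- `A` is a basis of order `k`: every sufficiently large integer is a sum of `k` elements
of `A`. -/
def IsBasisOfOrder (k : ℕ) (A : Set ℕ) : Prop :=
  ∃ N₀ : ℕ, ∀ N : ℕ, N₀ ≤ N → N ∈ kFoldSumset k A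

/-! Parity obstruction: put γ = 2kα and let N, P be odd. If n + m = N, then 2kα(m² - n²) = (m - n)P
+ (m - n)(γN - P), where (m - n)P is odd and the last term is at most |N(γN - P)|. If αn² and αm²
are both near integers, the left side is near an even integer, which is impossible when N(γN - P) is
close to some θ with |θ| < 1. This bounds constant ε. When ε → 0 it leaves the case of a bounded
summand n, which is excluded if γn² + θ is never an odd integer. Almost every γ has such N, P with θ
= 0: every irrational has odd/odd approximations of quality 13/q², and rescaling the radius changes
the limsup set only by a null set. For quadratic α, a Pell unit congruent to the identity mod 2
moves one odd pair (1, P₀) along an orbit on which N(γN - P) converges. -/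

theorem distNearestInt_neg (t : ℝ) : distNearestInt (-t) = distNearestInt t := by
  refine le_antisymm ?_ ?_
  · refine (distNearestInt_isLeast (-t)).2 ⟨-round t, ?_⟩
    rw [distNearestInt, ← abs_neg]
    push_cast
    ring_nf
  · refine (distNearestInt_isLeast t).2 ⟨-round (-t), ?_⟩
    rw [distNearestInt, ← abs_neg]
    push_cast
    ring_nf

theorem mem_quadBohrSet {ε : ℕ → ℝ} {α : ℝ} {n : ℕ} :
    n ∈ quadBohrSet ε α ↔ distNearestInt (α * (n : ℝ) ^ 2) < ε n :=
  Iff.rfl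

theorem quadBohrSet_neg (ε : ℕ → ℝ) (α : ℝ) : quadBohrSet ε (-α) = quadBohrSet ε α := by
  ext n
  simp only [mem_quadBohrSet, neg_mul, distNearestInt_neg]

theorem mem_kFoldSumset_two {A : Set ℕ} {N : ℕ} :
    N ∈ kFoldSumset 2 A ↔ ∃ n ∈ A, ∃ m ∈ A, n + m = N := by
  constructor
  · rintro ⟨f, hf, rfl⟩
    exact ⟨f 0, hf 0, f 1, hf 1, by simp [Fin.sum_univ_two]⟩
  · rintro ⟨n, hn, m, hm, rfl⟩
    refine ⟨![n, m], ?_, by simp [Fin.sum_univ_two]⟩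
    intro i
    fin_cases i
    · exact hn
    · exact hm

/-! ### The parity obstruction -/

/-- There are arbitrarily large odd `N` with an odd `P` such that `N (γ N - P)` is as close
to `θ` as desired. -/
def HasOddApprox (γ θ : ℝ) : Prop :=
  ∀ η : ℝ, 0 < η → ∀ N₀ : ℕ, ∃ N : ℕ, N₀ ≤ N ∧ Odd N ∧ ∃ P : ℤ, Odd P ∧
    |(N : ℝ) * (γ * N - P) - θ| < η

/-- Comparison of the phases of the two summands of `N`, scaled by `2 k`. -/
theorem odd_combination_identity {α γ : ℝ} {k n m N : ℕ} {P : ℤ} (hγ : γ = 2 * k * α)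
    (hN : n + m = N) :
    2 * k * (α * (m : ℝ) ^ 2) =
      2 * k * (α * (n : ℝ) ^ 2) + ((m : ℝ) - n) * P + ((m : ℝ) - n) * (γ * N - P) := by
  subst hN hγ
  push_cast
  ring

/-- Rounding both phases in the identity leaves an odd integer `z`, so |z| ≥ 1; |m - n| ≤ N bounds
the remaining term. -/
theorem one_le_of_add_eq {α γ : ℝ} {k n m N : ℕ} {P : ℤ} (hγ : γ = 2 * k * α)
    (hN : n + m = N) (hNodd : Odd N) (hP : Odd P) :
    1 ≤ |(N : ℝ) * (γ * N - P)| +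
      2 * k * (distNearestInt (α * (n : ℝ) ^ 2) + distNearestInt (α * (m : ℝ) ^ 2)) := by
  have key := odd_combination_identity (P := P) hγ hN
  set a := round (α * (m : ℝ) ^ 2)
  set b := round (α * (n : ℝ) ^ 2)
  set z : ℤ := 2 * k * (a - b) - ((m : ℤ) - n) * P with hz
  have hmn : Odd ((m : ℤ) - n) := by
    have : Odd ((N : ℕ) : ℤ) := by exact_mod_cast hNodd
    have h2 : (m : ℤ) - n = N - 2 * n := by rw [← hN]; push_cast; ring
    rw [h2]
    exact this.sub_even (even_two_mul _)
  have hzodd : Odd z := by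
    have : Odd (((m : ℤ) - n) * P) := hmn.mul hP
    exact Even.sub_odd (by rw [mul_assoc]; exact even_two_mul _) this
  have hz1 : (1 : ℝ) ≤ |(z : ℝ)| := by
    have : z ≠ 0 := by
      rintro h
      rw [h] at hzodd
      simp at hzodd
    exact_mod_cast Int.one_le_abs this
  have hzr : (z : ℝ) = ((m : ℝ) - n) * (γ * N - P) + 2 * k * (α * (n : ℝ) ^ 2 - b)
      - 2 * k * (α * (m : ℝ) ^ 2 - a) := by
    rw [hz]
    push_cast
    linarith
  have h1 : |((m : ℝ) - n) * (γ * N - P)| ≤ |(N : ℝ) * (γ * N - P)| := by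
    rw [abs_mul, abs_mul]
    refine mul_le_mul_of_nonneg_right ?_ (abs_nonneg _)
    have : (N : ℝ) = n + m := by rw [← hN]; push_cast; ring
    rw [this, abs_of_nonneg (by positivity : (0 : ℝ) ≤ n + m), abs_le]
    constructor <;> linarith [(Nat.cast_nonneg n : (0 : ℝ) ≤ n), (Nat.cast_nonneg m : (0 : ℝ) ≤ m)]
  have h2 : |2 * k * (α * (n : ℝ) ^ 2 - b)| = 2 * k * distNearestInt (α * (n : ℝ) ^ 2) := by
    rw [abs_mul, abs_of_nonneg (by positivity : (0 : ℝ) ≤ 2 * k)]; rfl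
  have h3 : |2 * k * (α * (m : ℝ) ^ 2 - a)| = 2 * k * distNearestInt (α * (m : ℝ) ^ 2) := by
    rw [abs_mul, abs_of_nonneg (by positivity : (0 : ℝ) ≤ 2 * k)]; rfl
  have h4 := abs_sub (((m : ℝ) - n) * (γ * N - P) + 2 * k * (α * (n : ℝ) ^ 2 - b))
    (2 * k * (α * (m : ℝ) ^ 2 - a))
  have h5 := abs_add_le (((m : ℝ) - n) * (γ * N - P)) (2 * k * (α * (n : ℝ) ^ 2 - b))
  rw [hzr] at hz1
  linarith

/-- The fractional obstruction for a fixed summand `n`. -/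
theorem exists_odd_abs_sub_le {α γ θ : ℝ} {k n m N : ℕ} {P : ℤ} (hγ : γ = 2 * k * α)
    (hN : n + m = N) (hNodd : Odd N) (hP : Odd P) :
    ∃ z : ℤ, Odd z ∧ |γ * (n : ℝ) ^ 2 + θ - z| ≤
      2 * k * distNearestInt (α * (m : ℝ) ^ 2) + |(N : ℝ) * (γ * N - P) - θ| +
        2 * n * |γ * N - P| := by
  have key := odd_combination_identity (P := P) hγ hN
  set a := round (α * (m : ℝ) ^ 2)
  have hmn : Odd ((m : ℤ) - n) := by
    have : Odd ((N : ℕ) : ℤ) := by exact_mod_cast hNodd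
    have h2 : (m : ℤ) - n = N - 2 * n := by rw [← hN]; push_cast; ring
    rw [h2]
    exact this.sub_even (even_two_mul _)
  refine ⟨2 * k * a - ((m : ℤ) - n) * P, ?_, ?_⟩
  · exact Even.sub_odd (by rw [mul_assoc]; exact even_two_mul _) (hmn.mul hP)
  have hm : (m : ℝ) = N - n := by rw [← hN]; push_cast; ring
  have e : γ * (n : ℝ) ^ 2 + θ - ((2 * k * a - ((m : ℤ) - n) * P : ℤ) : ℝ) =
      2 * k * (α * (m : ℝ) ^ 2 - a) - ((N : ℝ) * (γ * N - P) - θ) + 2 * n * (γ * N - P) := by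
    have : γ * (n : ℝ) ^ 2 = 2 * k * (α * (n : ℝ) ^ 2) := by rw [hγ]; ring
    have h1 : ((m : ℝ) - n) * (γ * N - P) = N * (γ * N - P) - 2 * n * (γ * N - P) := by
      rw [hm]; ring
    push_cast
    linarith
  have h3 : |2 * k * (α * (m : ℝ) ^ 2 - a)| = 2 * k * distNearestInt (α * (m : ℝ) ^ 2) := by
    rw [abs_mul, abs_of_nonneg (by positivity : (0 : ℝ) ≤ 2 * k)]; rfl
  have h4 : |2 * n * (γ * N - P)| = 2 * n * |γ * N - P| := by
    rw [abs_mul, abs_of_nonneg (by positivity : (0 : ℝ) ≤ 2 * n)]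
  rw [e, ← h3, ← h4]
  exact (abs_add_le _ _).trans (add_le_add_left (abs_sub _ _) _)

theorem exists_pos_le_abs_sub_odd {t : ℝ} (h : ∀ z : ℤ, Odd z → t ≠ z) :
    ∃ c : ℝ, 0 < c ∧ ∀ z : ℤ, Odd z → c ≤ |t - z| := by
  by_cases ht : t = round t
  · refine ⟨1, one_pos, fun z hz => ?_⟩
    have hne : round t - z ≠ 0 := fun h0 => h z hz (by rw [ht]; congr 1; omega)
    rw [ht]
    exact_mod_cast Int.one_le_abs hne
  · exact ⟨|t - round t|, abs_pos.2 (sub_ne_zero.2 ht), fun z _ => round_le t z⟩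

theorem not_isBasisOfOrder_two_of_le {α γ θ : ℝ} {k : ℕ} (hk : 0 < k) (hγ : γ = 2 * k * α)
    (happ : HasOddApprox γ θ) {ε : ℕ → ℝ} {ε₀ : ℝ} (hε₀ : ε₀ < (1 - |θ|) / (4 * k))
    (hε : ∀ n, ε n ≤ ε₀) : ¬ IsBasisOfOrder 2 (quadBohrSet ε α) := by
  rintro ⟨N₀, hN₀⟩
  have hk' : (0 : ℝ) < k := by exact_mod_cast hk
  rw [lt_div_iff₀ (by positivity)] at hε₀
  obtain ⟨N, hN, hNodd, P, hP, hNP⟩ := happ (1 - |θ| - ε₀ * (4 * k)) (by linarith) N₀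
  obtain ⟨n, hn, m, hm, hnm⟩ := mem_kFoldSumset_two.1 (hN₀ N hN)
  have h1 := one_le_of_add_eq hγ hnm hNodd hP
  have h2 : distNearestInt (α * (n : ℝ) ^ 2) ≤ ε₀ := (mem_quadBohrSet.1 hn).le.trans (hε n)
  have h3 : distNearestInt (α * (m : ℝ) ^ 2) ≤ ε₀ := (mem_quadBohrSet.1 hm).le.trans (hε m)
  have h4 := abs_sub_abs_le_abs_sub ((N : ℝ) * (γ * N - P)) θ
  have h5 : 2 * (k : ℝ) * (distNearestInt (α * (n : ℝ) ^ 2) + distNearestInt (α * (m : ℝ) ^ 2))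
      ≤ 2 * k * (ε₀ + ε₀) := by gcongr
  linarith

/-- Two large summands fall to the parity bound. If n < M, then ε n is uncontrolled, but the phase
of m is forced near γn² + θ modulo an odd integer, hence away from even integers shifted by it. -/
theorem not_isBasisOfOrder_two_of_tendsto {α γ θ : ℝ} {k : ℕ} (hk : 0 < k)
    (hγ : γ = 2 * k * α) (happ : HasOddApprox γ θ) (hθ : |θ| < 1)
    (hodd : ∀ n : ℕ, ∀ z : ℤ, Odd z → γ * (n : ℝ) ^ 2 + θ ≠ z) {ε : ℕ → ℝ}
    (hε : Filter.Tendsto ε Filter.atTop (nhds 0)) : ¬ IsBasisOfOrder 2 (quadBohrSet ε α) := by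
  rintro ⟨N₀, hN₀⟩
  have hk' : (0 : ℝ) < k := by exact_mod_cast hk
  have small : ∀ c : ℝ, 0 < c → ∃ M : ℕ, ∀ n, M ≤ n → 2 * k * ε n < c := by
    intro c hc
    have h : Filter.Tendsto (fun n => 2 * k * ε n) Filter.atTop (nhds 0) := by
      simpa using hε.const_mul (2 * (k : ℝ))
    exact Filter.eventually_atTop.1 (h.eventually_lt_const hc)
  obtain ⟨M, hM⟩ := small ((1 - |θ|) / 4) (by linarith)
  choose c hc hcz using fun n => exists_pos_le_abs_sub_odd (hodd n)
  -- Only finitely many n < M occur, so their gaps have a common positive lower bound.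
  obtain ⟨c₀, hc₀, hcc⟩ : ∃ c₀ : ℝ, 0 < c₀ ∧ ∀ n < M, c₀ ≤ c n := by
    clear hM
    induction M with
    | zero => exact ⟨1, one_pos, by simp⟩
    | succ M ih =>
      obtain ⟨c₀, h0, h1⟩ := ih
      refine ⟨min c₀ (c M), lt_min h0 (hc M), fun n hn => ?_⟩
      rcases Nat.lt_succ_iff_lt_or_eq.1 hn with h | rfl
      · exact (min_le_left _ _).trans (h1 n h)
      · exact min_le_right _ _
  obtain ⟨M', hM'⟩ := small (c₀ / 4) (by linarith)
  obtain ⟨K, hK⟩ := exists_nat_gt (8 * M / c₀)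
  -- The term 2M + M' forces m ≥ M' whenever n < M; K makes 2M|γN - P| < c₀/4, since N|γN - P| < 1.
  obtain ⟨N, hN, hNodd, P, hP, hNP⟩ := happ (min ((1 - |θ|) / 2) (c₀ / 4))
    (lt_min (by linarith) (by linarith)) (N₀ + 2 * M + M' + K + 1)
  have hNP1 := hNP.trans_le (min_le_left _ _)
  have hNP2 := hNP.trans_le (min_le_right _ _)
  have habs := abs_sub_abs_le_abs_sub ((N : ℝ) * (γ * N - P)) θ
  have hL : 2 * M * |γ * N - P| < c₀ / 4 := by
    have hNK : (K : ℝ) ≤ N := by exact_mod_cast (by omega : K ≤ N)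
    have hNpos : (0 : ℝ) < N := by exact_mod_cast (by omega : 0 < N)
    rw [abs_mul, abs_of_pos hNpos] at habs
    have h8 : 8 * M < c₀ * N := by
      rw [div_lt_iff₀ hc₀] at hK
      nlinarith
    by_contra! hcon
    have h9 : N * |γ * N - P| < 1 := by linarith
    have h10 := mul_le_mul_of_nonneg_left hcon hNpos.le
    have h11 : (0 : ℝ) ≤ M := Nat.cast_nonneg M
    nlinarith
  have main : ∀ n m : ℕ, n ∈ quadBohrSet ε α → m ∈ quadBohrSet ε α → n + m = N → ¬ n < M := by
    intro n m hn hm hnm hlt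
    obtain ⟨z, hz, hle⟩ := exists_odd_abs_sub_le (θ := θ) hγ hnm hNodd hP
    have h1 : 2 * k * distNearestInt (α * (m : ℝ) ^ 2) ≤ 2 * k * ε m := by
      have := (mem_quadBohrSet.1 hm).le
      gcongr
    have h2 := hM' m (by omega)
    have h3 : 2 * n * |γ * N - P| ≤ 2 * M * |γ * N - P| := by gcongr
    have h4 := hcz n z hz
    have h5 := hcc n hlt
    linarith
  obtain ⟨n, hn, m, hm, hnm⟩ := mem_kFoldSumset_two.1 (hN₀ N (by omega))
  have hnM := main n m hn hm hnm
  have hmM := main m n hm hn (by omega)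
  have h1 := one_le_of_add_eq hγ hnm hNodd hP
  have h2 : 2 * k * distNearestInt (α * (n : ℝ) ^ 2) ≤ 2 * k * ε n := by
    have := (mem_quadBohrSet.1 hn).le
    gcongr
  have h3 : 2 * k * distNearestInt (α * (m : ℝ) ^ 2) ≤ 2 * k * ε m := by
    have := (mem_quadBohrSet.1 hm).le
    gcongr
  have h4 := hM n (by omega)
  have h5 := hM m (by omega)
  linarith

/-! ### Odd/odd approximations to every irrational -/

/-- Dirichlet approximation; fractions of denominator at most n₀ stay a fixed distance from β, so a
close one has larger denominator. -/
theorem exists_coprime_abs_mul_sub_lt {β : ℝ} (hβ : Irrational β) (n₀ : ℕ) :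
    ∃ p q : ℤ, IsCoprime p q ∧ (n₀ : ℤ) < q ∧ q * |q * β - p| < 1 := by
  obtain ⟨ε, hε, hpos⟩ := ((Irrational.eventually_forall_le_dist_cast_rat_of_den_le hβ n₀).filter_mono
    (nhdsWithin_le_nhds (s := Set.Ioi 0)) |>.and self_mem_nhdsWithin).exists
  obtain ⟨n, hn⟩ := exists_nat_one_div_lt hpos
  obtain ⟨r, hr, hrn⟩ := Real.exists_rat_abs_sub_le_and_den_le β (Nat.succ_pos n)
  have hd : (0 : ℝ) < r.den := by exact_mod_cast r.den_pos
  have hd1 : (1 : ℝ) ≤ r.den := by exact_mod_cast r.den_pos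
  have hdn : (r.den : ℝ) ≤ n + 1 := by exact_mod_cast hrn
  have hn0 : (0 : ℝ) < n + 1 := by positivity
  have e : (r.den : ℝ) * |(r.den : ℝ) * β - r.num| = r.den ^ 2 * |β - r| := by
    have h1 : (r.den : ℝ) * β - r.num = r.den * (β - r) := by
      rw [mul_sub]
      congr 1
      have := Rat.den_mul_eq_num r
      exact_mod_cast this.symm
    rw [h1, abs_mul, abs_of_pos hd]
    ring
  rw [Nat.cast_succ, le_div_iff₀ (by positivity)] at hr
  refine ⟨r.num, r.den, ?_, ?_, ?_⟩
  · rw [Int.isCoprime_iff_gcd_eq_one]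
    simpa [Int.gcd] using r.reduced
  · by_contra! hle
    have h1 := hε r (by exact_mod_cast hle)
    rw [Real.dist_eq] at h1
    rw [div_lt_iff₀ hn0] at hn
    have h0 := abs_nonneg (β - r)
    nlinarith [mul_nonneg h0 hn0.le]
  · push_cast
    rw [e]
    have h0 := abs_nonneg (β - r)
    have h1 := mul_nonneg h0 hn0.le
    by_contra! hcon
    nlinarith [mul_le_mul_of_nonneg_left hdn (mul_nonneg hd.le h0)]

/-- Mod 2, (a, b) and (p, q) form a basis, so (1, 1) ≠ (p, q) is (a, b) or (a, b) + (p, q). Taking x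
= 2 instead of 0 keeps the new denominator at least q when b ≥ 0. -/
theorem exists_odd_add_mul {p q a b : ℤ} (h : Odd (a * q - b * p)) (hpq : ¬ (Odd p ∧ Odd q)) :
    ∃ x : ℤ, 1 ≤ x ∧ x ≤ 2 ∧ Odd (a + x * p) ∧ Odd (b + x * q) := by
  simp only [← Int.not_even_iff_odd, Int.even_sub, Int.even_mul, Int.even_add] at *
  by_cases h1 : (Even a ↔ ¬ Even p) ∧ (Even b ↔ ¬ Even q)
  · exact ⟨1, le_rfl, one_le_two, by simp; tauto⟩
  · exact ⟨2, one_le_two, le_rfl, by simp [-Int.not_even_iff_odd]; tauto⟩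

/-- Every irrational number has infinitely many approximations with odd numerator and
denominator of quadratic quality. -/
theorem exists_odd_odd_mul_abs_lt {β : ℝ} (hβ : Irrational β) (n₀ : ℕ) :
    ∃ P Q : ℤ, Odd P ∧ Odd Q ∧ (n₀ : ℤ) < Q ∧ Q * |Q * β - P| < 13 := by
  obtain ⟨p, q, hpq, hq, happ⟩ := exists_coprime_abs_mul_sub_lt hβ n₀
  have hq0 : 0 < q := by omega
  by_cases hodd : Odd p ∧ Odd q
  · exact ⟨p, q, hodd.1, hodd.2, hq, by linarith⟩
  obtain ⟨a, b, hb0, hbq, hab⟩ : ∃ a b : ℤ, 0 ≤ b ∧ b < q ∧ a * q - b * p = 1 := by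
    obtain ⟨s, t, hst⟩ := hpq
    -- Bézout coefficients, with b reduced modulo q.
    refine ⟨t + (-s) / q * (-p), (-s) % q, Int.emod_nonneg _ hq0.ne', Int.emod_lt_of_pos _ hq0, ?_⟩
    have := Int.emod_add_mul_ediv (-s) q
    linear_combination hst - p * this
  obtain ⟨x, hx1, hx2, hP, hQ⟩ := exists_odd_add_mul (hab ▸ odd_one) hodd
  refine ⟨_, _, hP, hQ, by nlinarith, ?_⟩
  have hqr : (0 : ℝ) < q := by exact_mod_cast hq0
  have hbq' : (b : ℝ) < q := by exact_mod_cast hbq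
  have hb0' : (0 : ℝ) ≤ b := by exact_mod_cast hb0
  have hx1' : (1 : ℝ) ≤ x := by exact_mod_cast hx1
  have hx2' : (x : ℝ) ≤ 2 := by exact_mod_cast hx2
  have hab' : (a : ℝ) * q - b * p = 1 := by exact_mod_cast hab
  push_cast
  set δ := (q : ℝ) * β - p with hδ
  have e : q * ((b + x * q) * β - (a + x * p)) = (b + x * q) * δ - 1 := by
    rw [hδ]; linear_combination -hab'
  have hQ0 : (0 : ℝ) ≤ b + x * q := by positivity
  -- With q|δ| < 1, q times the error is below 3 + 1; Q ≤ 3q then gives 12 < 13.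
  have hQ3 : (b + x * q : ℝ) ≤ 3 * q := by nlinarith
  have h2 : q * |(b + x * q) * β - (a + x * p)| ≤ (b + x * q) * |δ| + 1 := by
    rw [← abs_of_pos hqr, ← abs_mul, abs_of_pos hqr, e]
    refine (abs_sub _ _).trans ?_
    rw [abs_mul, abs_of_nonneg hQ0, abs_one]
  have h3 : (b + x * q) * |δ| ≤ 3 * q * |δ| := by gcongr
  have h4 := mul_le_mul_of_nonneg_right hQ3 (abs_nonneg ((b + x * q) * β - (a + x * p)))
  linarith

/-! ### Almost every α -/

/-- The rationals with odd numerator and denominator `q`. -/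
def oddFractions (q : ℕ) : Set ℝ := {x | ∃ p : ℤ, Odd p ∧ x = p / q}

theorem mem_blimsup_thickening_oddFractions {r : ℕ → ℝ} {β : ℝ} :
    β ∈ (Filter.blimsup (fun q => Metric.thickening (r q) (oddFractions q)) Filter.atTop
        (fun q : ℕ => Odd q) : Set ℝ) ↔
      ∀ n₀ : ℕ, ∃ q : ℕ, n₀ < q ∧ Odd q ∧ ∃ p : ℤ, Odd p ∧ |β - p / q| < r q := by
  rw [← Nat.cofinite_eq_atTop, Filter.cofinite.blimsup_set_eq, Set.mem_ofPred_eq,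
    Set.infinite_iff_exists_gt]
  refine forall_congr' fun n₀ => ?_
  constructor
  · rintro ⟨q, ⟨hq, hβ⟩, hn⟩
    obtain ⟨_, ⟨p, hp, rfl⟩, h⟩ := Metric.mem_thickening_iff.1 hβ
    exact ⟨q, hn, hq, p, hp, h⟩
  · rintro ⟨q, hn, hq, p, hp, h⟩
    exact ⟨q, ⟨hq, Metric.mem_thickening_iff.2 ⟨_, ⟨p, hp, rfl⟩, h⟩⟩, hn⟩

theorem mul_abs_mul_sub_lt_iff {β c : ℝ} {q : ℕ} (hq : 0 < q) (p : ℤ) :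
    |β - p / q| < c * (1 / (q : ℝ) ^ 2) ↔ q * |q * β - p| < c := by
  have hq' : (0 : ℝ) < q := by exact_mod_cast hq
  have e : (q : ℝ) * β - p = q * (β - p / q) := by field_simp
  rw [e, abs_mul, abs_of_pos hq', mul_one_div, lt_div_iff₀ (by positivity)]
  ring_nf

/-- The constant 13, valid for all irrationals, may be replaced by each 1/(j + 1) outside a null
set; countably many j suffice. -/
theorem ae_hasOddApprox_zero : ∀ᵐ β : ℝ, HasOddApprox β 0 := by
  have hr : Filter.Tendsto (fun q : ℕ => 1 / (q : ℝ) ^ 2) Filter.atTop (nhds 0) :=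
    tendsto_const_div_pow 1 2 two_ne_zero
  have hirr : ∀ᵐ β : ℝ, Irrational β :=
    Set.Countable.ae_notMem (Set.countable_range ((↑) : ℚ → ℝ)) _
  have hsmall : ∀ j : ℕ, ∀ᵐ β : ℝ, ∀ n₀ : ℕ, ∃ q : ℕ, n₀ < q ∧ Odd q ∧ ∃ p : ℤ, Odd p ∧
      |β - p / q| < 1 / ((j : ℝ) + 1) * (1 / (q : ℝ) ^ 2) := by
    intro j
    have h1 := blimsup_thickening_mul_ae_eq MeasureTheory.volume (fun q : ℕ => Odd q) oddFractions
      (by positivity : (0 : ℝ) < 1 / ((j : ℝ) + 1)) _ hr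
    have h2 := blimsup_thickening_mul_ae_eq MeasureTheory.volume (fun q : ℕ => Odd q) oddFractions
      (by norm_num : (0 : ℝ) < 13) _ hr
    filter_upwards [h1.mem_iff, h2.mem_iff, hirr] with β e1 e2 hβ
    rw [← mem_blimsup_thickening_oddFractions (r := fun q => 1 / ((j : ℝ) + 1) * (1 / (q : ℝ) ^ 2)),
      e1, ← e2, mem_blimsup_thickening_oddFractions]
    intro n₀
    obtain ⟨P, Q, hP, hQ, hn, hlt⟩ := exists_odd_odd_mul_abs_lt hβ n₀
    lift Q to ℕ using by omega
    refine ⟨Q, by exact_mod_cast hn, by exact_mod_cast hQ, P, hP, ?_⟩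
    rw [mul_abs_mul_sub_lt_iff (by omega)]
    exact_mod_cast hlt
  filter_upwards [MeasureTheory.ae_all_iff.2 hsmall] with β hβ η hη N₀
  obtain ⟨j, hj⟩ := exists_nat_one_div_lt hη
  obtain ⟨q, hn, hq, p, hp, hlt⟩ := hβ j N₀
  refine ⟨q, hn.le, hq, p, hp, ?_⟩
  rw [mul_abs_mul_sub_lt_iff (by omega)] at hlt
  rw [sub_zero, abs_mul, Nat.abs_cast, mul_comm β]
  exact hlt.trans hj

theorem exists_null_set_forall_not_isBasisOfOrder_two :
    ∃ Z : Set ℝ, MeasureTheory.volume Z = 0 ∧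
      ∀ α : ℝ, α ∉ Z →
        (∀ ε : ℕ → ℝ, Filter.Tendsto ε Filter.atTop (nhds 0) →
          ¬ IsBasisOfOrder 2 (quadBohrSet ε α)) ∧
        (∀ (ε : ℕ → ℝ) (ε₀ : ℝ), ε₀ < 1 / 4 → (∀ n : ℕ, ε n ≤ ε₀) →
          ¬ IsBasisOfOrder 2 (quadBohrSet ε α)) := by
  have h2 : ∀ᵐ α : ℝ, HasOddApprox (2 * α) 0 ∧ Irrational (2 * α) := by
    have hirr : ∀ᵐ β : ℝ, Irrational β :=
      Set.Countable.ae_notMem (Set.countable_range ((↑) : ℚ → ℝ)) _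
    -- Doubling pulls null sets back to null sets.
    exact (MeasureTheory.Measure.quasiMeasurePreserving_smul MeasureTheory.volume
      (two_ne_zero (α := ℝ))).ae (ae_hasOddApprox_zero.and hirr)
  refine ⟨{α | ¬ (HasOddApprox (2 * α) 0 ∧ Irrational (2 * α))}, h2, fun α hα => ?_⟩
  obtain ⟨happ, hirr⟩ : HasOddApprox (2 * α) 0 ∧ Irrational (2 * α) := by
    simpa only [Set.mem_ofPred_eq, not_not] using hα
  have hγ : 2 * α = 2 * ((1 : ℕ) : ℝ) * α := by simp
  refine ⟨fun ε hε => ?_, fun ε ε₀ h0 hε => ?_⟩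
  · refine not_isBasisOfOrder_two_of_tendsto one_pos hγ happ (by simp) (fun n z hz h => ?_) hε
    rcases Nat.eq_zero_or_pos n with rfl | hn
    · have : z = 0 := by
        have : (z : ℝ) = 0 := by rw [← h]; simp
        exact_mod_cast this
      rw [this] at hz
      simp at hz
    · have h1 := hirr.mul_natCast (pow_ne_zero 2 hn.ne')
      refine h1.ne_int z ?_
      push_cast
      linarith
  · exact not_isBasisOfOrder_two_of_le one_pos hγ happ (by simpa using h0) hε

/-! ### Quadratic irrationals -/

theorem exists_eq_add_mul_sqrt_of_mem_adjoin {d : ℕ} {α : ℝ}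
    (h : α ∈ IntermediateField.adjoin ℚ {Real.sqrt (d : ℝ)}) :
    ∃ r s : ℚ, α = r + s * Real.sqrt d := by
  have hsq : Real.sqrt (d : ℝ) * Real.sqrt d = d := Real.mul_self_sqrt (Nat.cast_nonneg d)
  have halg : IsAlgebraic ℚ (Real.sqrt (d : ℝ)) := by
    refine IsAlgebraic.of_pow two_pos ?_
    rw [sq, hsq]
    exact isAlgebraic_natCast d
  rw [← IntermediateField.mem_toSubalgebra,
    IntermediateField.adjoin_simple_toSubalgebra_of_isAlgebraic halg] at h
  induction h using Algebra.adjoin_induction with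
  | mem x hx => exact ⟨0, 1, by rw [Set.mem_singleton_iff.1 hx]; simp⟩
  | algebraMap q => exact ⟨q, 0, by simp⟩
  | add x y _ _ hx hy =>
    obtain ⟨r, s, rfl⟩ := hx
    obtain ⟨r', s', rfl⟩ := hy
    exact ⟨r + r', s + s', by push_cast; ring⟩
  | mul x y _ _ hx hy =>
    obtain ⟨r, s, rfl⟩ := hx
    obtain ⟨r', s', rfl⟩ := hy
    exact ⟨r * r' + s * s' * d, r * s' + s * r', by
      push_cast; linear_combination (s : ℝ) * s' * hsq⟩

theorem irrational_ratCast_add_mul {t : ℝ} (ht : Irrational t) (a : ℚ) {b : ℚ} (hb : b ≠ 0) :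
    Irrational (a + b * t) :=
  (ht.ratCast_mul hb).ratCast_add a

/-- Some large multiple of an irrational number has odd integral part. -/
theorem exists_odd_floor_natCast_mul {β : ℝ} (hβ : Irrational β) (K : ℕ) :
    ∃ k : ℕ, K ≤ k ∧ 0 < k ∧ Odd ⌊(k : ℝ) * β⌋ := by
  by_contra! hcon
  have heven : ∀ k : ℕ, K ≤ k → 0 < k → Even ⌊(k : ℝ) * β⌋ := fun k h1 h2 => by
    rw [← Int.not_odd_iff_even]
    exact hcon k h1 h2
  set x := Int.fract (((K + 1 : ℕ) : ℝ) * β / 2) with hx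
  have hx0 : 0 < x := by
    refine Int.fract_pos.2 fun h => ?_
    have h1 := (hβ.natCast_mul (Nat.succ_ne_zero K)).div_natCast (two_ne_zero (α := ℕ))
    exact h1.ne_int _ (by exact_mod_cast h)
  have hfl : ∀ j : ℕ, ∃ m : ℤ, 2 ^ j * ((K + 1 : ℕ) * β / 2) = 2 ^ j * x + m := fun j =>
    ⟨2 ^ j * ⌊((K + 1 : ℕ) : ℝ) * β / 2⌋, by
      push_cast
      rw [← mul_add, hx]
      congr 1
      exact_mod_cast (Int.fract_add_floor _).symm⟩
  -- Even floors mean that every binary digit of x is 0, contradicting x > 0.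
  have hlt : ∀ j : ℕ, 2 ^ j * x < 1 / 2 := by
    have step : ∀ j : ℕ, 2 ^ j * x < 1 → 2 ^ j * x < 1 / 2 := by
      intro j hj
      obtain ⟨m, hm⟩ := hfl j
      by_contra! hge
      have h1 := heven (2 ^ j * (K + 1)) (by nlinarith [Nat.one_le_two_pow (n := j)]) (by positivity)
      have h2 : ⌊((2 ^ j * (K + 1) : ℕ) : ℝ) * β⌋ = 2 * m + 1 := by
        rw [Int.floor_eq_iff]
        push_cast at hm ⊢
        constructor <;> linarith
      rw [h2] at h1
      exact Int.not_even_two_mul_add_one m h1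
    intro j
    induction j with
    | zero => exact step 0 (by simpa using Int.fract_lt_one _)
    | succ j ih => exact step _ (by rw [pow_succ]; linarith)
  obtain ⟨j, hj⟩ := pow_unbounded_of_one_lt (1 / x) one_lt_two
  rw [div_lt_iff₀ hx0] at hj
  linarith [hlt j]

/-- A unit `κ ∈ (0, 1)` acting on the lattice spanned by `1` and the quadratic irrational
`(r + s √d) / w`, preserving the parity of both coordinates. -/
theorem exists_unit_action {d : ℕ} (hd : Irrational (Real.sqrt d)) (r s w : ℤ) (hs : 0 < s)
    (hw : 0 < w) :
    ∃ κ : ℝ, 0 < κ ∧ κ < 1 ∧ ∀ N P : ℤ, Odd N → Odd P → ∃ N' P' : ℤ, Odd N' ∧ Odd P' ∧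
      (r + s * Real.sqrt d) / w * N' - P' = κ * ((r + s * Real.sqrt d) / w * N - P) ∧
      (r - s * Real.sqrt d) / w * N' - P' = κ⁻¹ * ((r - s * Real.sqrt d) / w * N - P) := by
  have hw' : (w : ℝ) ≠ 0 := by exact_mod_cast hw.ne'
  have hs' : (0 : ℝ) < s := by exact_mod_cast hs
  have hw0 : (0 : ℝ) < w := by exact_mod_cast hw
  have hsq : Real.sqrt (d : ℝ) ^ 2 = d := Real.sq_sqrt (Nat.cast_nonneg d)
  have hd0 : 0 < d := by
    rcases Nat.eq_zero_or_pos d with rfl | h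
    · simp at hd
    · exact h
  -- The factor 2ws in the Pell equation makes x odd and the action integral and trivial mod 2.
  have hdns : ¬ IsSquare ((2 * w * s) ^ 2 * (d : ℤ)) := by
    rintro ⟨t, ht⟩
    have ht' : ((2 * w * s) * Real.sqrt d) ^ 2 = (t : ℝ) ^ 2 := by
      rw [mul_pow, hsq, sq (t : ℝ)]
      exact_mod_cast ht
    have hirr : Irrational (((2 * w * s : ℤ) : ℝ) * Real.sqrt d) := hd.intCast_mul (by positivity)
    rcases sq_eq_sq_iff_eq_or_eq_neg.1 ht' with h | h
    · exact hirr.ne_int t (by exact_mod_cast h)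
    · exact hirr.ne_int (-t) (by exact_mod_cast h)
  obtain ⟨a, hx1, hy0⟩ := Pell.Solution₁.exists_pos_of_not_isSquare (by positivity) hdns
  obtain ⟨x, hx⟩ : ∃ x, x = a.x := ⟨_, rfl⟩
  obtain ⟨y, hy⟩ : ∃ y, y = a.y := ⟨_, rfl⟩
  have hp := a.prop
  rw [← hx, ← hy] at hp
  rw [← hx] at hx1
  rw [← hy] at hy0
  have hxodd : Odd x := by
    have : Odd (x ^ 2) := by
      refine ⟨2 * (w * s) ^ 2 * d * y ^ 2, ?_⟩
      linear_combination hp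
    exact (Int.odd_pow.1 this).resolve_right two_ne_zero
  set t := Real.sqrt (d : ℝ)
  have ht0 : 0 ≤ t := Real.sqrt_nonneg _
  have hx1' : (1 : ℝ) < x := by exact_mod_cast hx1
  have hy0' : (0 : ℝ) < y := by exact_mod_cast hy0
  have hpr : (x : ℝ) ^ 2 - (2 * w * s) ^ 2 * d * y ^ 2 = 1 := by exact_mod_cast hp
  have hinv : ((x : ℝ) - 2 * w * s * t * y) * (x + 2 * w * s * t * y) = 1 := by
    rw [← hpr, ← hsq]; ring
  have hpos : (1 : ℝ) < x + 2 * w * s * t * y := by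
    have : 0 ≤ 2 * w * s * t * y := by positivity
    linarith
  have hκ : ((x : ℝ) - 2 * w * s * t * y)⁻¹ = x + 2 * w * s * t * y :=
    inv_eq_of_mul_eq_one_right hinv
  have hκ0 : 0 < (x : ℝ) - 2 * w * s * t * y := by
    rw [← inv_pos, hκ]
    linarith
  refine ⟨_, hκ0, ?_, fun N P hN hP => ⟨N * x + 2 * (w ^ 2 * y * P - w * r * y * N),
    P * x + 2 * (w * r * y * P - N * y * (r ^ 2 - s ^ 2 * d)),
    (hN.mul hxodd).add_even (even_two_mul _), (hP.mul hxodd).add_even (even_two_mul _), ?_, ?_⟩⟩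
  · by_contra! hcon
    nlinarith
  · push_cast
    rw [← hsq]
    field_simp
    ring
  · rw [hκ]
    push_cast
    rw [← hsq]
    field_simp
    ring

/-- With u = γN - P and u' = γ'N - P, N·u = (u² - uu')/(γ - γ'). The product uu' is constant on the
orbit and u → 0; γ' < P₀ makes N → +∞. -/
theorem hasOddApprox_of_unit_action {γ γ' κ : ℝ} {P₀ : ℤ} (hP₀ : Odd P₀) (h0 : 0 < γ - P₀)
    (h1 : γ - P₀ < γ - γ') (hκ0 : 0 < κ) (hκ1 : κ < 1)
    (hact : ∀ N P : ℤ, Odd N → Odd P → ∃ N' P' : ℤ, Odd N' ∧ Odd P' ∧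
      γ * N' - P' = κ * (γ * N - P) ∧ γ' * N' - P' = κ⁻¹ * (γ' * N - P)) :
    HasOddApprox γ ((γ - P₀) * (P₀ - γ') / (γ - γ')) := by
  have hg : 0 < γ - γ' := h0.trans h1
  have hneg : 0 < P₀ - γ' := by linarith
  have horbit : ∀ j : ℕ, ∃ N P : ℤ, Odd N ∧ Odd P ∧ γ * N - P = κ ^ j * (γ - P₀) ∧
      γ' * N - P = (κ⁻¹) ^ j * (γ' - P₀) := by
    intro j
    induction j with
    | zero => exact ⟨1, P₀, odd_one, hP₀, by simp, by simp⟩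
    | succ j ih =>
      obtain ⟨N, P, hN, hP, e1, e2⟩ := ih
      obtain ⟨N', P', hN', hP', e1', e2'⟩ := hact N P hN hP
      exact ⟨N', P', hN', hP', by rw [e1', e1]; ring, by rw [e2', e2]; ring⟩
  intro η hη N₀
  have hκi : 1 < κ⁻¹ := (one_lt_inv₀ hκ0).2 hκ1
  have hlim1 : Filter.Tendsto (fun j : ℕ => κ ^ j) Filter.atTop (nhds 0) :=
    tendsto_pow_atTop_nhds_zero_of_lt_one hκ0.le hκ1
  have hlim2 : Filter.Tendsto (fun j : ℕ => (κ⁻¹) ^ j) Filter.atTop Filter.atTop :=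
    tendsto_pow_atTop_atTop_of_one_lt hκi
  obtain ⟨j, hj1, hj2⟩ := ((hlim1.eventually_lt_const
    (show 0 < η * (γ - γ') / (γ - P₀) ^ 2 by positivity)).and
    (hlim2.eventually_gt_atTop (N₀ * (γ - γ') / (P₀ - γ')))).exists
  obtain ⟨N, P, hN, hP, e1, e2⟩ := horbit j
  have hκj0 : 0 < κ ^ j := pow_pos hκ0 j
  have hκj1 : κ ^ j ≤ 1 := pow_le_one₀ hκ0.le hκ1.le
  have hinv : κ ^ j * (κ⁻¹) ^ j = 1 := by rw [← mul_pow, mul_inv_cancel₀ hκ0.ne', one_pow]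
  have hNg : N * (γ - γ') = κ ^ j * (γ - P₀) + (κ⁻¹) ^ j * (P₀ - γ') := by linarith
  have hN₀ : (N₀ : ℝ) < N := by
    rw [div_lt_iff₀ hneg] at hj2
    have : 0 < κ ^ j * (γ - P₀) := by positivity
    exact lt_of_mul_lt_mul_right (by linarith : (N₀ : ℝ) * (γ - γ') < N * (γ - γ')) hg.le
  have hN₀' : (N₀ : ℤ) < N := by exact_mod_cast hN₀
  lift N to ℕ using by omega
  refine ⟨N, by omega, by exact_mod_cast hN, P, hP, ?_⟩
  push_cast at e1 hNg
  have e : (N : ℝ) * (γ * N - P) - (γ - P₀) * (P₀ - γ') / (γ - γ') =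
      (κ ^ j) ^ 2 * (γ - P₀) ^ 2 / (γ - γ') := by
    rw [e1, eq_div_iff hg.ne', sub_mul, div_mul_cancel₀ _ hg.ne']
    linear_combination κ ^ j * (γ - P₀) * hNg + (γ - P₀) * (P₀ - γ') * hinv
  rw [e, abs_of_pos (by positivity), div_lt_iff₀ hg]
  rw [lt_div_iff₀ (by positivity)] at hj1
  refine lt_of_le_of_lt ?_ hj1
  refine mul_le_mul_of_nonneg_right ?_ (by positivity)
  exact pow_le_of_le_one hκj0.le hκj1 two_ne_zero

/-- A quadratic irrational `α` larger than its conjugate has a multiple `2 k α` admitting good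
approximations by fractions with odd numerator and denominator. -/
theorem exists_hasOddApprox_mul {d : ℕ} (hd : Irrational (Real.sqrt d)) (r : ℚ) {s : ℚ}
    (hs : 0 < s) :
    ∃ (k : ℕ) (θ : ℝ), 0 < k ∧ |θ| < 1 ∧ HasOddApprox (2 * k * (r + s * Real.sqrt d)) θ ∧
      ∀ n : ℕ, Irrational (2 * k * (r + s * Real.sqrt d) * (n : ℝ) ^ 2 + θ) := by
  have ht0 : 0 < Real.sqrt (d : ℝ) :=
    lt_of_le_of_ne (Real.sqrt_nonneg _) (fun h => hd.ne_zero h.symm)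
  have hsq : Real.sqrt (d : ℝ) ^ 2 = d := Real.sq_sqrt (Nat.cast_nonneg d)
  set t := Real.sqrt (d : ℝ)
  have hsr : (0 : ℝ) < s := by exact_mod_cast hs
  have hirr : Irrational (2 * ((r : ℝ) + s * t)) := by
    simpa using (irrational_ratCast_add_mul hd r hs.ne').natCast_mul two_ne_zero
  -- For k ≥ K this gives γ - γ' > 1, so ⌊γ⌋ lies strictly between γ' and γ.
  obtain ⟨K, hK⟩ := exists_nat_gt (1 / (4 * s * t))
  obtain ⟨k, hKk, hk, hP₀⟩ := exists_odd_floor_natCast_mul hirr K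
  rw [show (k : ℝ) * (2 * (r + s * t)) = 2 * k * (r + s * t) by ring] at hP₀
  have hk' : (0 : ℝ) < k := by exact_mod_cast hk
  set γ : ℝ := 2 * k * (r + s * t) with hγ
  set γ' : ℝ := 2 * k * (r - s * t) with hγ'
  set P₀ := ⌊γ⌋
  have hγirr : Irrational γ := by
    rw [hγ, show 2 * k * (r + s * t) = (k : ℝ) * (2 * (r + s * t)) by ring]
    exact hirr.natCast_mul hk.ne'
  have h0 : 0 < γ - P₀ := by
    have := lt_of_le_of_ne (Int.floor_le γ) (hγirr.ne_int _).symm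
    linarith
  have h1 : γ - P₀ < 1 := by linarith [Int.lt_floor_add_one γ]
  have hgk : γ - γ' = k * (4 * s * t) := by rw [hγ, hγ']; ring
  have hg1 : 1 < γ - γ' := by
    rw [div_lt_iff₀ (by positivity)] at hK
    rw [hgk]
    refine hK.trans_le ?_
    have : (K : ℝ) ≤ k := by exact_mod_cast hKk
    gcongr
  have hg0 : 0 < γ - γ' := by linarith
  have hw : 0 < ((r.den * s.den : ℕ) : ℤ) := by exact_mod_cast Nat.mul_pos r.den_pos s.den_pos
  obtain ⟨κ, hκ0, hκ1, hact⟩ := exists_unit_action hd (2 * k * r.num * s.den)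
    (2 * k * s.num * r.den) (r.den * s.den : ℕ)
    (by have := Rat.num_pos.2 hs; have := r.den_pos; positivity) hw
  have hrd : (r.den : ℝ) ≠ 0 := by exact_mod_cast r.den_nz
  have hsd : (s.den : ℝ) ≠ 0 := by exact_mod_cast s.den_nz
  have hr' : (r : ℝ) = r.num / r.den := Rat.cast_def r
  have hs' : (s : ℝ) = s.num / s.den := Rat.cast_def s
  have e1 : (((2 * k * r.num * s.den : ℤ) : ℝ) + ((2 * k * s.num * r.den : ℤ) : ℝ) * t) /
      (((r.den * s.den : ℕ) : ℤ) : ℝ) = γ := by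
    rw [hγ, hr', hs']
    push_cast
    field_simp
  have e2 : (((2 * k * r.num * s.den : ℤ) : ℝ) - ((2 * k * s.num * r.den : ℤ) : ℝ) * t) /
      (((r.den * s.den : ℕ) : ℤ) : ℝ) = γ' := by
    rw [hγ', hr', hs']
    push_cast
    field_simp
  rw [e1, e2] at hact
  have happ := hasOddApprox_of_unit_action hP₀ h0 (h1.trans hg1) hκ0 hκ1 hact
  have hθ0 : 0 < (γ - P₀) * (P₀ - γ') / (γ - γ') :=
    div_pos (mul_pos h0 (by linarith)) hg0
  -- θ = ab/(a + b) with a = γ - P₀ < 1 and b = P₀ - γ' > 0, hence θ < a.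
  have hθ1 : (γ - P₀) * (P₀ - γ') / (γ - γ') < 1 := by
    rw [div_lt_one hg0]
    nlinarith
  refine ⟨k, _, hk, by rwa [abs_of_pos hθ0], happ, fun n => ?_⟩
  -- θ = c√d with c > 0, so its √d-coefficient cannot cancel the nonnegative one of γn².
  set c : ℚ := ((2 * k * s) ^ 2 * d - (2 * k * r - P₀) ^ 2) / (4 * k * s * d) with hc
  have hdpos : (0 : ℝ) < d := by rw [← hsq]; positivity
  have hθc : (γ - P₀) * (P₀ - γ') / (γ - γ') = c * t := by
    rw [hgk, div_eq_iff (by positivity), hc, hγ, hγ']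
    push_cast
    rw [← hsq]
    field_simp
    ring
  have hcpos : 0 < c := by
    rw [hθc] at hθ0
    exact_mod_cast pos_of_mul_pos_left hθ0 ht0.le
  have e : γ * (n : ℝ) ^ 2 + (γ - P₀) * (P₀ - γ') / (γ - γ') =
      ((2 * k * r * n ^ 2 : ℚ) : ℝ) + ((2 * k * s * n ^ 2 + c : ℚ) : ℝ) * t := by
    rw [hθc, hγ]
    push_cast
    ring
  rw [e]
  exact irrational_ratCast_add_mul hd _ (by positivity)

theorem not_isBasisOfOrder_two_of_quadratic {d : ℕ} {α : ℝ}
    (hα : α ∈ IntermediateField.adjoin ℚ {Real.sqrt (d : ℝ)}) (hirr : Irrational α) :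
    (∀ ε : ℕ → ℝ, Filter.Tendsto ε Filter.atTop (nhds 0) →
        ¬ IsBasisOfOrder 2 (quadBohrSet ε α)) ∧
      (∃ ε₁ : ℝ, 0 < ε₁ ∧
        ∀ (ε : ℕ → ℝ) (ε₀ : ℝ), ε₀ < ε₁ → (∀ n : ℕ, ε n ≤ ε₀) →
          ¬ IsBasisOfOrder 2 (quadBohrSet ε α)) := by
  obtain ⟨r, s, rfl⟩ := exists_eq_add_mul_sqrt_of_mem_adjoin hα
  have hs : s ≠ 0 := by
    rintro rfl
    exact hirr.ne_rat r (by simp)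
  have hd : Irrational (Real.sqrt d) := by
    rintro ⟨q, hq⟩
    exact hirr.ne_rat (r + s * q) (by rw [← hq]; push_cast; rfl)
  have main : ∀ r s : ℚ, 0 < s → (∀ ε : ℕ → ℝ, Filter.Tendsto ε Filter.atTop (nhds 0) →
        ¬ IsBasisOfOrder 2 (quadBohrSet ε (r + s * Real.sqrt d))) ∧
      (∃ ε₁ : ℝ, 0 < ε₁ ∧
        ∀ (ε : ℕ → ℝ) (ε₀ : ℝ), ε₀ < ε₁ → (∀ n : ℕ, ε n ≤ ε₀) →
          ¬ IsBasisOfOrder 2 (quadBohrSet ε (r + s * Real.sqrt d))) := by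
    intro r s hs
    obtain ⟨k, θ, hk, hθ, happ, hodd⟩ := exists_hasOddApprox_mul hd r hs
    refine ⟨fun ε hε => not_isBasisOfOrder_two_of_tendsto hk rfl happ hθ
      (fun n z _ => (hodd n).ne_int z) hε, (1 - |θ|) / (4 * k), ?_, fun ε ε₀ h0 hε =>
      not_isBasisOfOrder_two_of_le hk rfl happ h0 hε⟩
    have : (0 : ℝ) < k := by exact_mod_cast hk
    exact div_pos (by linarith) (by positivity)
  rcases lt_or_gt_of_ne hs with h | h
  · have e : (r : ℝ) + s * Real.sqrt d = -(((-r : ℚ) : ℝ) + ((-s : ℚ) : ℝ) * Real.sqrt d) := by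
      push_cast; ring
    simp only [e, quadBohrSet_neg]
    exact main (-r) (-s) (by linarith)
  · exact main r s h

theorem mainTheorem1 :
    (∃ Z : Set ℝ, MeasureTheory.volume Z = 0 ∧
      ∀ α : ℝ, α ∉ Z →
        (∀ ε : ℕ → ℝ, Filter.Tendsto ε Filter.atTop (nhds 0) →
          ¬ IsBasisOfOrder 2 (quadBohrSet ε α)) ∧
        (∀ (ε : ℕ → ℝ) (ε₀ : ℝ), ε₀ < 1 / 4 → (∀ n : ℕ, ε n ≤ ε₀) →
          ¬ IsBasisOfOrder 2 (quadBohrSet ε α))) ∧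
    (∀ (d : ℕ) (α : ℝ), α ∈ IntermediateField.adjoin ℚ {Real.sqrt (d : ℝ)} → Irrational α →
      (∀ ε : ℕ → ℝ, Filter.Tendsto ε Filter.atTop (nhds 0) →
        ¬ IsBasisOfOrder 2 (quadBohrSet ε α)) ∧
      (∃ ε₁ : ℝ, 0 < ε₁ ∧
        ∀ (ε : ℕ → ℝ) (ε₀ : ℝ), ε₀ < ε₁ → (∀ n : ℕ, ε n ≤ ε₀) →
          ¬ IsBasisOfOrder 2 (quadBohrSet ε α))) :=
  ⟨exists_null_set_forall_not_isBasisOfOrder_two,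
    fun _ _ hα hirr => not_isBasisOfOrder_two_of_quadratic hα hirr⟩
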